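/- Let $k$ be an algebraically closed field of characteristic $p>0$, let $\tilde G$ be a finite group, $G$ a normal subgroup of $\tilde G$, and let modules be finitely generated left modules. For a $kG$-module $U$ and $x\in\tilde G$, let $xU$ denote the conjugate $kG$-module, i.e. $U$ with $g\in G$ acting as $x^{-1}gx$ acts on $U$, and let $\operatorname{Ind}_G^{\tilde G}U = k\tilde G\otimes_{kG}U$. For a module $U$ over a finite-dimensional $k$-algebra $\Lambda$, let $P(U)\to U$ be the projective cover, $\Omega(U)$ its kernel (the syzygy), and $\tau U=D\operatorname{Tr}U$ the Auslander–Reiten translate, where $\operatorname{Tr}U$ is the cokernel of $\operatorname{Hom}_\Lambda(P(U),\Lambda)\to\operatorname{Hom}_\Lambda(P(\Omega(U)),\Lambda)$ and $D=\operatorname{Hom}_k(-,k)$. Let $M$ be a $kG$-module such that $xM\cong M$ as $kG$-modules for every $x\in\tilde G$. Then: 1. $xP(M)\cong P(M)$ as $kG$-modules for every $x\in\tilde G$; 2. $x\Omega(M)\cong\Omega(M)$ as $kG$-modules for every $x\in\tilde G$; 3. $\operatorname{Ind}_G^{\tilde G}\Omega(M)\cong\Omega(\operatorname{Ind}_G^{\tilde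 G}M)$ as $k\tilde G$-modules; 4. $\tau(\operatorname{Ind}_G^{\tilde G}M)\cong\operatorname{Ind}_G^{\tilde G}(\tau M)$ as $k\tilde G$-modules. -/

import Mathlib

open scoped TensorProduct

universe u v w

noncomputable section

/-! ### Projective covers and syzygies over a (left) Artinian ring -/

section ProjectiveCover

variable {A : Type u} [Ring A]

/-- `π : P → M` is a projective cover of the left `A`-module `M`: `P` is projective and `π` is an
essential epimorphism, i.e. it is surjective and its kernel is a superfluous submodule of `P`. -/
structure IsProjectiveCover {P : Type v} {M : Type w} [AddCommGroup P] [Module A P]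
    [AddCommGroup M] [Module A M] (π : P →ₗ[A] M) : Prop where
  projective : Module.Projective A P
  surjective : Function.Surjective π
  essential : ∀ N : Submodule A P, N ⊔ LinearMap.ker π = ⊤ → N = ⊤

/-- Finitely generated modules over an Artinian ring have a projective cover, which can be found
inside a free module of finite rank. -/
theorem exists_isProjectiveCover [IsArtinianRing A] (M : Type w) [AddCommGroup M] [Module A M]
    [Module.Finite A M] :
    ∃ (n : ℕ) (N : Submodule A (Fin n → A)) (π : N →ₗ[A] M), IsProjectiveCover π := by
  obtain ⟨n, q, hq⟩ := Module.Finite.exists_fin' A M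
  -- a minimal submodule on which `q` is still surjective
  obtain ⟨N, hN, hmin⟩ := WellFounded.has_min (r := fun a b : Submodule A (Fin n → A) => a < b)
    wellFounded_lt {N : Submodule A (Fin n → A) | N.map q = ⊤}
    ⟨⊤, by simpa [LinearMap.range_eq_top] using hq⟩
  have hmin' : ∀ L : Submodule A (Fin n → A), L ≤ N → L.map q = ⊤ → L = N := fun L hL h =>
    (hL.eq_or_lt).resolve_right (hmin L h)
  have hsurj : Function.Surjective (q.comp N.subtype) := by
    intro m
    have : m ∈ N.map q := by rw [show N.map q = ⊤ from hN]; trivial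
    obtain ⟨y, hy, rfl⟩ := this
    exact ⟨⟨y, hy⟩, rfl⟩
  obtain ⟨f, hf⟩ := Module.projective_lifting_property (q.comp N.subtype) q hsurj
  have hf' : ∀ y, q (f y : Fin n → A) = q y := fun y => LinearMap.congr_fun hf y
  let e : N →ₗ[A] N := f.comp N.subtype
  have hesurj : Function.Surjective e := by
    have h1 : (LinearMap.range (N.subtype.comp e)) = N := by
      apply hmin'
      · rintro _ ⟨y, rfl⟩
        exact (e y).2
      · rw [eq_top_iff]
        rintro m -
        obtain ⟨y, rfl⟩ := hsurj m
        exact ⟨_, ⟨y, rfl⟩, hf' _⟩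
    intro y
    have hy : (y : Fin n → A) ∈ LinearMap.range (N.subtype.comp e) := by rw [h1]; exact y.2
    obtain ⟨z, hz⟩ := hy
    exact ⟨z, Subtype.ext hz⟩
  have hebij : Function.Bijective e :=
    ⟨IsNoetherian.injective_of_surjective_endomorphism e hesurj, hesurj⟩
  let E := LinearEquiv.ofBijective e hebij
  refine ⟨n, N, q.comp N.subtype, ?_, hsurj, ?_⟩
  · refine Module.Projective.of_split (N.subtype.comp E.symm.toLinearMap) f ?_
    ext1 y
    exact E.apply_symm_apply y
  · intro L hL
    have h2 : L.map N.subtype = N := by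
      apply hmin'
      · rintro _ ⟨y, -, rfl⟩
        exact y.2
      · rw [eq_top_iff]
        rintro m -
        obtain ⟨y, rfl⟩ := hsurj m
        have hy : y ∈ L ⊔ LinearMap.ker (q.comp N.subtype) := by rw [hL]; trivial
        obtain ⟨a, ha, b, hb, rfl⟩ := Submodule.mem_sup.1 hy
        refine ⟨_, ⟨a, ha, rfl⟩, ?_⟩
        rw [map_add, LinearMap.mem_ker.1 hb, add_zero]
        rfl
    rw [eq_top_iff]
    rintro y -
    have hy : (y : Fin n → A) ∈ L.map N.subtype := by rw [h2]; exact y.2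
    obtain ⟨z, hz, hzy⟩ := hy
    rwa [← (Subtype.ext hzy : z = y)]

variable (A) [IsArtinianRing A] (M : Type w) [AddCommGroup M] [Module A M] [Module.Finite A M]

/-- The underlying module `P(M)` of a (fixed) projective cover of `M`; it is unique up to
isomorphism. -/
def ProjCover : Type u := (exists_isProjectiveCover (A := A) M).choose_spec.choose

instance : AddCommGroup (ProjCover A M) :=
  inferInstanceAs (AddCommGroup (exists_isProjectiveCover (A := A) M).choose_spec.choose)

instance : Module A (ProjCover A M) :=
  inferInstanceAs (Module A (exists_isProjectiveCover (A := A) M).choose_spec.choose)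

instance : Module.Finite A (ProjCover A M) :=
  inferInstanceAs (Module.Finite A (exists_isProjectiveCover (A := A) M).choose_spec.choose)

/-- The structure map `π_M : P(M) → M`. -/
def projCoverMap : ProjCover A M →ₗ[A] M :=
  (exists_isProjectiveCover (A := A) M).choose_spec.choose_spec.choose

theorem isProjectiveCover_projCoverMap : IsProjectiveCover (projCoverMap A M) :=
  (exists_isProjectiveCover (A := A) M).choose_spec.choose_spec.choose_spec

/-- The syzygy `Ω(M)`, the kernel of `π_M : P(M) → M`. -/
abbrev Syzygy : Type u := LinearMap.ker (projCoverMap A M)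

/-- The map `P₁ = P(Ω(M)) → P(M) = P₀` in the minimal projective presentation
`P₁ → P₀ → M → 0`. -/
def minPresMap : ProjCover A (Syzygy A M) →ₗ[A] ProjCover A M :=
  (LinearMap.ker (projCoverMap A M)).subtype.comp (projCoverMap A (Syzygy A M))

end ProjectiveCover

/-! ### The Auslander–Reiten translate `τ = D Tr` -/

section AuslanderReiten

/-- The functor `Hom_A(-, A)` from left `A`-modules to right `A`-modules, on morphisms.  The right
action on `Hom_A(P, A)` is `(f · a) y = (f y) * a`. -/
def homRegularMap (A : Type u) [Ring A] {P : Type v} {Q : Type w} [AddCommGroup P] [Module A P]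
    [AddCommGroup Q] [Module A Q] (d : P →ₗ[A] Q) : (Q →ₗ[A] A) →ₗ[Aᵐᵒᵖ] (P →ₗ[A] A) where
  toFun f := f.comp d
  map_add' _ _ := rfl
  map_smul' _ _ := rfl

/-- The `k`-dual `D X = Hom_k(X, k)` of a right module `X` over the `k`-algebra `A`. -/
def KDual (k : Type u) [Field k] (X : Type w) [AddCommGroup X] [Module k X] : Type (max u w) :=
  X →ₗ[k] k

instance (k : Type u) [Field k] (X : Type w) [AddCommGroup X] [Module k X] :
    AddCommGroup (KDual k X) :=
  inferInstanceAs (AddCommGroup (X →ₗ[k] k))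

/-- The left `A`-module structure on `D X`, given by `(a • φ) x = φ (x · a)`. -/
instance (k : Type u) [Field k] (A : Type v) [Ring A] [Algebra k A] (X : Type w) [AddCommGroup X]
    [Module k X] [Module Aᵐᵒᵖ X] [IsScalarTower k Aᵐᵒᵖ X] : Module A (KDual k X) where
  smul a φ :=
    { toFun := fun x => (show X →ₗ[k] k from φ) (MulOpposite.op a • x)
      map_add' := fun x y => by rw [smul_add, map_add]
      map_smul' := fun c x => by
        rw [← algebraMap_smul Aᵐᵒᵖ c x, ← mul_smul, ← Algebra.commutes, mul_smul,
          algebraMap_smul, map_smul, RingHom.id_apply] }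
  one_smul φ := LinearMap.ext fun x => congrArg (show X →ₗ[k] k from φ) (one_smul Aᵐᵒᵖ x)
  mul_smul a b φ := LinearMap.ext fun x =>
    congrArg (show X →ₗ[k] k from φ) (mul_smul (MulOpposite.op b) (MulOpposite.op a) x)
  smul_zero _ := rfl
  smul_add _ _ _ := rfl
  add_smul a b φ := LinearMap.ext fun x =>
    (congrArg (show X →ₗ[k] k from φ)
      (add_smul (MulOpposite.op a) (MulOpposite.op b) x)).trans (map_add _ _ _)
  zero_smul φ := LinearMap.ext fun x =>
    (congrArg (show X →ₗ[k] k from φ) (zero_smul Aᵐᵒᵖ x)).trans (map_zero _)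

variable (A : Type u) [Ring A] [IsArtinianRing A]
  (M : Type w) [AddCommGroup M] [Module A M] [Module.Finite A M]

/-- The transpose `Tr M`, a right `A`-module: the cokernel of
`Hom_A(P₀, A) → Hom_A(P₁, A)` for the minimal projective presentation `P₁ → P₀ → M → 0`. -/
abbrev Transpose : Type u :=
  (ProjCover A (Syzygy A M) →ₗ[A] A) ⧸ LinearMap.range (homRegularMap A (minPresMap A M))

/-- The Auslander–Reiten translate `τ M = D Tr M`. -/
abbrev ARTranslate (k : Type v) [Field k] [Algebra k A] : Type (max v u) :=
  KDual k (Transpose A M)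

end AuslanderReiten

/-! ### Tensor products over a noncommutative ring, and induction -/

section Induction

variable {A : Type u} {B : Type v} [Ring A] [Ring B]

/-- The `B`-submodule of `B ⊗_ℤ M` by which one divides in order to obtain `B ⊗_A M`, where `B` is
a right `A`-module through the ring homomorphism `φ : A → B`. -/
def balancingSubmodule (φ : A →+* B) (M : Type w) [AddCommGroup M] [Module A M] :
    Submodule B (B ⊗[ℤ] M) :=
  Submodule.span B {t | ∃ (b : B) (a : A) (m : M), t = (b * φ a) ⊗ₜ[ℤ] m - b ⊗ₜ[ℤ] (a • m)}

/-- The left `B`-module `B ⊗_A M` for a ring homomorphism `φ : A → B` and a left `A`-module `M`. -/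
abbrev BaseChange (φ : A →+* B) (M : Type w) [AddCommGroup M] [Module A M] : Type (max v w) :=
  (B ⊗[ℤ] M) ⧸ balancingSubmodule φ M

instance baseChange_finite (φ : A →+* B) (M : Type w) [AddCommGroup M] [Module A M]
    [Module.Finite A M] : Module.Finite B (BaseChange φ M) := by
  classical
  obtain ⟨s, hs⟩ := (Module.Finite.fg_top : (⊤ : Submodule A M).FG)
  let ι : M → BaseChange φ M := fun m => (balancingSubmodule φ M).mkQ (1 ⊗ₜ[ℤ] m)
  have hι : ∀ (a : A) (m : M), ι (a • m) = φ a • ι m := by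
    intro a m
    symm
    change (balancingSubmodule φ M).mkQ (φ a • (1 ⊗ₜ[ℤ] m)) = _
    rw [TensorProduct.smul_tmul', smul_eq_mul, mul_one, ← sub_eq_zero, ← map_sub]
    refine (Submodule.Quotient.mk_eq_zero _).2 (Submodule.subset_span ⟨1, a, m, ?_⟩)
    rw [one_mul]
  have hadd : ∀ m m' : M, ι (m + m') = ι m + ι m' := fun m m' => by
    simp only [ι, TensorProduct.tmul_add, map_add]
  refine ⟨⟨s.image ι, ?_⟩⟩
  rw [Finset.coe_image, eq_top_iff]
  have hmem : ∀ m : M, ι m ∈ Submodule.span B (ι '' (s : Set M)) := by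
    intro m
    have hm : m ∈ Submodule.span A (s : Set M) := by rw [hs]; trivial
    induction hm using Submodule.span_induction with
    | mem x hx => exact Submodule.subset_span ⟨x, hx, rfl⟩
    | zero => simp [ι]
    | add x y _ _ hx hy => rw [hadd]; exact add_mem hx hy
    | smul a x _ hx => rw [hι]; exact Submodule.smul_mem _ _ hx
  rintro t -
  obtain ⟨t, rfl⟩ := Submodule.mkQ_surjective _ t
  induction t with
  | zero => rw [map_zero]; exact zero_mem _
  | add x y hx hy => rw [map_add]; exact add_mem hx hy
  | tmul b m =>
    have : (balancingSubmodule φ M).mkQ (b ⊗ₜ[ℤ] m) = b • ι m := by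
      change _ = (balancingSubmodule φ M).mkQ (b • (1 ⊗ₜ[ℤ] m))
      rw [TensorProduct.smul_tmul', smul_eq_mul, mul_one]
    rw [this]
    exact Submodule.smul_mem _ _ (hmem m)

end Induction

/-! ### Group algebras -/

section GroupAlgebra

instance groupAlgebra_isArtinianRing (k : Type u) [Field k] (G : Type v) [Group G] [Finite G] :
    IsArtinianRing (MonoidAlgebra k G) :=
  IsArtinianRing.of_finite k (MonoidAlgebra k G)

variable (k : Type u) [Field k] {Gt : Type v} [Group Gt] (G : Subgroup Gt)

/-- The induced module `Ind_G^Gt M = k[Gt] ⊗_{k[G]} M` of a `k[G]`-module `M`. -/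
abbrev Ind (M : Type w) [AddCommGroup M] [Module (MonoidAlgebra k G) M] : Type (max u v w) :=
  BaseChange (MonoidAlgebra.mapDomainRingHom k G.subtype) M

variable {G} in
/-- The conjugate `xM` of a `k[G]`-module `M` by `x : Gt`, where `G` is normal in `Gt`: the same
additive group, on which `g ∈ G` acts as `x⁻¹ * g * x` acts on `M`. -/
@[nolint unusedArguments]
def ConjMod (_x : Gt) (M : Type w) : Type w := M

instance (x : Gt) (M : Type w) [AddCommGroup M] : AddCommGroup (ConjMod x M) :=
  inferInstanceAs (AddCommGroup M)

instance [G.Normal] (x : Gt) (M : Type w) [AddCommGroup M] [Module (MonoidAlgebra k G) M] :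
    Module (MonoidAlgebra k G) (ConjMod x M) :=
  Module.compHom M (MonoidAlgebra.mapDomainRingHom k
    ((MulAut.conjNormal x⁻¹ : MulAut G) : G →* G))

end GroupAlgebra

end

/-! Projective covers are unique up to an isomorphism compatible with the covering maps. Conjugation
by `x` twists the action by a ring automorphism, so it carries the cover of `M` to a cover of `xM`.
An isomorphism `xM ≅ M` therefore lifts to the covers and restricts to their kernels, which gives
the first two statements.

For induction, put `A = k[G]` and `B = k[Gt]`. Then `A → B` is a Frobenius extension: `E : B → A`
discards the coefficients outside `G`, and coset representatives `t i` and their inverses `s i` are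
dual bases. The functionals `b ↦ E (s i * b)` give natural coordinates on `B ⊗_A M`, so induction is
exact. By normality of `G`, each map `m ↦ t i ⊗ m` is semilinear over an automorphism of `A`. The
kernel of an induced cover is a finite sum of images of the old kernel under these maps, hence
superfluous. Induction thus preserves projective covers, syzygies and minimal presentations
(`isProjectiveCover_map`, `exists_baseChange_ker_equiv`).

For `τ`, extension of linear forms and restriction followed by `E` relate the two transposes. The
dual basis identities turn these maps into an isomorphism between the induced dual and the dual over
`B` (`nonempty_baseChange_kDual_equiv`). -/

/-! ### Superfluous submodules and uniqueness of projective covers -/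

section ProjectiveCoverUniqueness

variable {A : Type*} [Ring A]

/-- A submodule `K` is superfluous if `N ⊔ K = ⊤` implies `N = ⊤`. -/
def Submodule.IsSuperfluous {P : Type*} [AddCommGroup P] [Module A P] (K : Submodule A P) : Prop :=
  ∀ N : Submodule A P, N ⊔ K = ⊤ → N = ⊤

/-- If `N ⊔ K.map f = ⊤`, then `N.comap f ⊔ K = ⊤`, so `N` contains the whole image of `f`, in
particular `K.map f`. Semilinearity is allowed because conjugation twists scalars. -/
theorem Submodule.IsSuperfluous.map {A' : Type*} [Ring A'] {σ : A →+* A'} [RingHomSurjective σ]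
    {P Q : Type*} [AddCommGroup P] [Module A P] [AddCommGroup Q] [Module A' Q]
    {K : Submodule A P} (hK : K.IsSuperfluous) (f : P →ₛₗ[σ] Q) : (K.map f).IsSuperfluous := by
  intro N hN
  have h : N.comap f = ⊤ := by
    refine hK _ (eq_top_iff.2 fun p _ => ?_)
    obtain ⟨n, hn, _, ⟨x, hx, rfl⟩, hs⟩ :=
      Submodule.mem_sup.1 (show f p ∈ N ⊔ K.map f by rw [hN]; trivial)
    refine Submodule.mem_sup.2 ⟨p - x, ?_, x, hx, sub_add_cancel _ _⟩
    rw [Submodule.mem_comap, map_sub, ← hs, add_sub_cancel_right]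
    exact hn
  have h' : K.map f ≤ N := Submodule.map_le_iff_le_comap.2 (h ▸ le_top)
  rw [← hN, sup_eq_left.2 h']

theorem Submodule.IsSuperfluous.iSup {ι : Type*} [Finite ι] {P : Type*} [AddCommGroup P]
    [Module A P] {K : ι → Submodule A P} (hK : ∀ i, (K i).IsSuperfluous) :
    (⨆ i, K i).IsSuperfluous := by
  have := Fintype.ofFinite ι
  classical
  rw [← Finset.sup_univ_eq_iSup]
  generalize (Finset.univ : Finset ι) = s
  induction s using Finset.induction_on with
  | empty => intro N hN; simpa using hN
  | insert i s _ ih =>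
    intro N hN
    rw [Finset.sup_insert, ← sup_assoc] at hN
    exact hK i N (ih _ hN)

/-- Projective covers of isomorphic modules are isomorphic. -/
theorem IsProjectiveCover.exists_equiv {P P' M M' : Type*} [AddCommGroup P] [Module A P]
    [AddCommGroup P'] [Module A P'] [AddCommGroup M] [Module A M] [AddCommGroup M'] [Module A M']
    {π : P →ₗ[A] M} {π' : P' →ₗ[A] M'} (hπ : IsProjectiveCover π) (hπ' : IsProjectiveCover π')
    (h : M ≃ₗ[A] M') : ∃ e : P ≃ₗ[A] P', ∀ x, π' (e x) = h (π x) := by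
  have := hπ.projective
  have := hπ'.projective
  obtain ⟨e, he⟩ := Module.projective_lifting_property π' (h.toLinearMap.comp π) hπ'.surjective
  have he' : ∀ x, π' (e x) = h (π x) := fun x => LinearMap.congr_fun he x
  have hsurj : Function.Surjective e := by
    rw [← LinearMap.range_eq_top]
    refine hπ'.essential _ (eq_top_iff.2 fun y _ => ?_)
    obtain ⟨x, hx⟩ := hπ.surjective (h.symm (π' y))
    refine Submodule.mem_sup.2 ⟨e x, ⟨x, rfl⟩, y - e x, ?_, add_sub_cancel _ _⟩
    rw [LinearMap.mem_ker, map_sub, he', hx, h.apply_symm_apply, sub_self]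
  obtain ⟨s, hs⟩ := Module.projective_lifting_property e LinearMap.id hsurj
  have hs' : ∀ y, e (s y) = y := fun y => LinearMap.congr_fun hs y
  -- The section `s` is onto because its range and `ker π` together span; hence `e` is also
  -- injective.
  have hssurj : Function.Surjective s := by
    rw [← LinearMap.range_eq_top]
    refine hπ.essential _ (eq_top_iff.2 fun x _ => ?_)
    refine Submodule.mem_sup.2 ⟨s (e x), ⟨_, rfl⟩, x - s (e x), ?_, add_sub_cancel _ _⟩
    rw [LinearMap.mem_ker, ← h.map_eq_zero_iff, ← he', map_sub, hs', sub_self, map_zero]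
  refine ⟨LinearEquiv.ofBijective e ⟨?_, hsurj⟩, he'⟩
  intro x y hxy
  obtain ⟨x, rfl⟩ := hssurj x
  obtain ⟨y, rfl⟩ := hssurj y
  rw [← hs' x, ← hs' y, hxy]

/-- Being a projective cover is invariant under semilinear isomorphisms. -/
theorem IsProjectiveCover.of_semilinearEquiv {A' : Type*} [Ring A'] {σ : A →+* A'} {σ' : A' →+* A}
    [RingHomInvPair σ σ'] [RingHomInvPair σ' σ] {P P' M M' : Type*} [AddCommGroup P] [Module A P]
    [AddCommGroup P'] [Module A' P'] [AddCommGroup M] [Module A M] [AddCommGroup M'] [Module A' M']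
    {π : P →ₗ[A] M} {π' : P' →ₗ[A'] M'} (hπ : IsProjectiveCover π) (e : P ≃ₛₗ[σ] P')
    (h : M ≃ₛₗ[σ] M') (he : ∀ x, π' (e x) = h (π x)) : IsProjectiveCover π' where
  projective := by
    have := hπ.projective
    exact Module.Projective.of_equiv e
  surjective y := by
    obtain ⟨x, hx⟩ := hπ.surjective (h.symm y)
    exact ⟨e x, by rw [he, hx, h.apply_symm_apply]⟩
  essential := by
    have hk : LinearMap.ker π' = (LinearMap.ker π).map e.toLinearMap := by
      ext y
      constructor
      · intro hy
        refine ⟨e.symm y, ?_, e.apply_symm_apply y⟩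
        have := he (e.symm y)
        rw [e.apply_symm_apply, LinearMap.mem_ker.1 hy] at this
        exact (h.map_eq_zero_iff.1 this.symm)
      · rintro ⟨x, hx, rfl⟩
        change π' (e x) = 0
        rw [he, LinearMap.mem_ker.1 hx, map_zero]
    rw [hk]
    exact Submodule.IsSuperfluous.map hπ.essential e.toLinearMap

/-- The formula for `f` is kept because `τ` needs the whole square of presentations, not just
isomorphic kernels. -/
theorem LinearMap.exists_ker_equiv {P P' M M' : Type*} [AddCommGroup P] [Module A P]
    [AddCommGroup P'] [Module A P'] [AddCommGroup M] [Module A M] [AddCommGroup M'] [Module A M']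
    {π : P →ₗ[A] M} {π' : P' →ₗ[A] M'} (e : P ≃ₗ[A] P') (h : M ≃ₗ[A] M')
    (he : ∀ x, π' (e x) = h (π x)) :
    ∃ f : LinearMap.ker π ≃ₗ[A] LinearMap.ker π', ∀ x, (f x : P') = e x := by
  have hk : (LinearMap.ker π).map e.toLinearMap = LinearMap.ker π' := by
    ext y
    obtain ⟨x, rfl⟩ := e.surjective y
    rw [LinearMap.mem_ker, he, h.map_eq_zero_iff]
    simp
  exact ⟨e.submoduleMap _ ≪≫ₗ LinearEquiv.ofEq _ _ hk, fun _ => rfl⟩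

end ProjectiveCoverUniqueness

/-! ### The tensor product `B ⊗_A M` and its universal property -/

section BaseChange

variable {A B : Type*} [Ring A] [Ring B] (φ : A →+* B)
variable {M N : Type*} [AddCommGroup M] [Module A M] [AddCommGroup N] [Module A N]

namespace BaseChange

/-- The pure tensor `b ⊗ m` in `B ⊗_A M`. -/
def tmul (b : B) (m : M) : BaseChange φ M := (balancingSubmodule φ M).mkQ (b ⊗ₜ[ℤ] m)

variable {φ}

theorem tmul_add (b : B) (m m' : M) : tmul φ b (m + m') = tmul φ b m + tmul φ b m' := by
  simp only [tmul, TensorProduct.tmul_add, map_add]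

theorem smul_tmul (c b : B) (m : M) : c • tmul φ b m = tmul φ (c * b) m := by
  rw [tmul, ← map_smul, TensorProduct.smul_tmul', smul_eq_mul, tmul]

theorem mul_tmul (b : B) (a : A) (m : M) : tmul φ (b * φ a) m = tmul φ b (a • m) := by
  rw [← sub_eq_zero, tmul, tmul, ← map_sub]
  exact (Submodule.Quotient.mk_eq_zero _).2 (Submodule.subset_span ⟨b, a, m, rfl⟩)

@[elab_as_elim]
theorem induction {p : BaseChange φ M → Prop} (zero : p 0) (tmul : ∀ b m, p (tmul φ b m))
    (add : ∀ x y, p x → p y → p (x + y)) (y : BaseChange φ M) : p y := by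
  obtain ⟨t, rfl⟩ := Submodule.mkQ_surjective _ y
  induction t with
  | zero => rwa [map_zero]
  | add x y hx hy => rw [map_add]; exact add _ _ hx hy
  | tmul b m => exact tmul b m

/-- The additive map out of `B ⊗_A M` defined by a balanced biadditive map. -/
def liftAddHom {X : Type*} [AddCommGroup X] (f : B →+ M →+ X)
    (hf : ∀ b a m, f (b * φ a) m = f b (a • m)) : BaseChange φ M →+ X :=
  QuotientAddGroup.lift (balancingSubmodule φ M).toAddSubgroup
    (TensorProduct.liftAddHom (R := ℤ) f fun r b m => by
      rw [map_zsmul, map_zsmul, AddMonoidHom.zsmul_apply]) (by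
    intro t ht
    -- The map is only additive while the balancing submodule is a `B`-span, so the vanishing is
    -- strengthened to all multiples `c • t`.
    suffices h : ∀ c : B, TensorProduct.liftAddHom (R := ℤ) f (fun r b m => by
        rw [map_zsmul, map_zsmul, AddMonoidHom.zsmul_apply]) (c • t) = 0 by
      simpa using h 1
    replace ht : t ∈ balancingSubmodule φ M := ht
    rw [balancingSubmodule] at ht
    induction ht using Submodule.span_induction with
    | mem x hx =>
      obtain ⟨b, a, m, rfl⟩ := hx
      intro c
      simp only [smul_sub, TensorProduct.smul_tmul', smul_eq_mul, map_sub,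
        TensorProduct.liftAddHom_tmul, ← mul_assoc, hf, sub_self]
    | zero => intro c; rw [smul_zero, map_zero]
    | add x y _ _ hx hy => intro c; rw [smul_add, map_add, hx, hy, add_zero]
    | smul d x _ hx => intro c; rw [← mul_smul]; exact hx _)

/-- The `B`-linear map out of `B ⊗_A M` defined by a `φ`-semilinear map. -/
def lift {X : Type*} [AddCommGroup X] [Module B X] (f : M →ₛₗ[φ] X) : BaseChange φ M →ₗ[B] X :=
  let F : BaseChange φ M →+ X :=
    liftAddHom ((smulAddHom B X).flip.comp f.toAddMonoidHom).flip fun b a m => by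
      change (b * φ a) • f m = b • f (a • m)
      rw [map_smulₛₗ, mul_smul]
  { F with
    map_smul' := fun c y => by
      change F (c • y) = c • F y
      induction y using BaseChange.induction with
      | zero => rw [smul_zero, map_zero, smul_zero]
      | tmul b m => rw [smul_tmul]; exact mul_smul c b (f m)
      | add x y hx hy => rw [smul_add, map_add, map_add, smul_add, hx, hy] }

theorem lift_tmul {X : Type*} [AddCommGroup X] [Module B X] (f : M →ₛₗ[φ] X) (b : B) (m : M) :
    lift f (tmul φ b m) = b • f m := rfl

variable (φ M) in
/-- The canonical map `M → B ⊗_A M`. -/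
def unit : M →ₛₗ[φ] BaseChange φ M where
  toFun m := tmul φ 1 m
  map_add' := tmul_add 1
  map_smul' a m := by rw [smul_tmul, mul_one, ← mul_tmul, one_mul]

theorem unit_apply (m : M) : unit φ M m = tmul φ 1 m := rfl

theorem smul_unit (b : B) (m : M) : b • unit φ M m = tmul φ b m := by
  rw [unit_apply, smul_tmul, mul_one]

variable (φ) in
/-- Functoriality of `B ⊗_A -`. -/
def map (f : M →ₗ[A] N) : BaseChange φ M →ₗ[B] BaseChange φ N := lift ((unit φ N).comp f)

theorem map_tmul (f : M →ₗ[A] N) (b : B) (m : M) : map φ f (tmul φ b m) = tmul φ b (f m) :=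
  smul_unit b (f m)

theorem hom_ext {X : Type*} [AddCommGroup X] [Module B X] {f g : BaseChange φ M →ₗ[B] X}
    (h : ∀ m, f (tmul φ 1 m) = g (tmul φ 1 m)) : f = g := by
  refine LinearMap.ext fun y => ?_
  induction y using BaseChange.induction with
  | zero => rw [map_zero, map_zero]
  | tmul b m => rw [← smul_unit, map_smul, map_smul]; exact congrArg (b • ·) (h m)
  | add x y hx hy => rw [map_add, map_add, hx, hy]

theorem map_surjective {f : M →ₗ[A] N} (hf : Function.Surjective f) :
    Function.Surjective (map φ f) := by
  intro y
  induction y using BaseChange.induction with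
  | zero => exact ⟨0, map_zero _⟩
  | tmul b m =>
    obtain ⟨m, rfl⟩ := hf m
    exact ⟨tmul φ b m, map_tmul f b m⟩
  | add x y hx hy =>
    obtain ⟨x, rfl⟩ := hx
    obtain ⟨y, rfl⟩ := hy
    exact ⟨x + y, map_add _ _ _⟩

/-- Base change is left adjoint to restriction of scalars: to split a surjection from a free
`B`-module, lift the unit over `A` and extend the lift `B`-linearly. -/
theorem projective (hM : Module.Projective A M) : Module.Projective B (BaseChange φ M) := by
  refine Module.Projective.of_lifting_property'' fun f hf => ?_
  let _ : Module A (BaseChange φ M →₀ B) := Module.compHom _ φ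
  let _ : Module A (BaseChange φ M) := Module.compHom _ φ
  let fA : (BaseChange φ M →₀ B) →ₗ[A] BaseChange φ M :=
    { f with map_smul' := fun a x => f.map_smul (φ a) x }
  let uA : M →ₗ[A] BaseChange φ M := { unit φ M with map_smul' := (unit φ M).map_smulₛₗ }
  obtain ⟨g, hg⟩ := Module.projective_lifting_property fA uA hf
  refine ⟨lift { g with map_smul' := g.map_smul }, hom_ext fun m => ?_⟩
  rw [LinearMap.comp_apply, lift_tmul, one_smul]
  exact LinearMap.congr_fun hg m

end BaseChange

end BaseChange

/-! ### Frobenius extensions: coordinates, exactness, projective covers -/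

section FrobeniusExtension

variable {A B : Type*} [Ring A] [Ring B]

/-- A Frobenius system for a ring homomorphism `φ : A → B`: an `A`-bimodule homomorphism `E : B → A`
and dual bases `t`, `s`, whose elements `t i` moreover normalize the image of `A`. -/
structure NormalFrobeniusSystem (φ : A →+* B) (ι : Type*) [Fintype ι] where
  /-- The Frobenius homomorphism. -/
  E : B →+ A
  E_mul_left : ∀ a b, E (φ a * b) = a * E b
  E_mul_right : ∀ b a, E (b * φ a) = E b * a
  /-- The first dual basis. -/
  t : ι → B
  /-- The second dual basis. -/
  s : ι → B
  sum_mul_s : ∀ b, ∑ i, φ (E (b * t i)) * s i = b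
  sum_t_mul : ∀ b, ∑ i, t i * φ (E (s i * b)) = b
  /-- The automorphism of `A` induced by conjugation with `t i`. -/
  σ : ι → A ≃+* A
  t_mul : ∀ i a, t i * φ a = φ (σ i a) * t i

namespace NormalFrobeniusSystem

open BaseChange

variable {φ : A →+* B} {ι : Type*} [Fintype ι] (F : NormalFrobeniusSystem φ ι)
variable {M N : Type*} [AddCommGroup M] [Module A M] [AddCommGroup N] [Module A N]

variable (M) in
/-- The `i`-th coordinate map `b ⊗ m ↦ E (s i * b) • m`. -/
def coord (i : ι) : BaseChange φ M →+ M :=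
  liftAddHom ((smulAddHom A M).comp (F.E.comp (AddMonoidHom.mulLeft (F.s i)))) fun b a m => by
    change F.E (F.s i * (b * φ a)) • m = F.E (F.s i * b) • a • m
    rw [← mul_assoc, F.E_mul_right, mul_smul]

theorem coord_tmul (i : ι) (b : B) (m : M) :
    F.coord M i (tmul φ b m) = F.E (F.s i * b) • m := rfl

/-- Expand `b = ∑ i, t i * φ (E (s i * b))` and move the scalars across the tensor sign. -/
theorem sum_tmul_coord (y : BaseChange φ M) : ∑ i, tmul φ (F.t i) (F.coord M i y) = y := by
  induction y using BaseChange.induction with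
  | zero => simpa using Finset.sum_eq_zero fun i _ =>
      (smul_unit (F.t i) (0 : M)).symm.trans (by rw [map_zero, smul_zero])
  | tmul b m =>
    simp_rw [coord_tmul, ← mul_tmul, ← smul_unit, ← Finset.sum_smul, F.sum_t_mul]
  | add x y hx hy => simp_rw [map_add, tmul_add, Finset.sum_add_distrib, hx, hy]

theorem coord_map (f : M →ₗ[A] N) (i : ι) (y : BaseChange φ M) :
    F.coord N i (BaseChange.map φ f y) = f (F.coord M i y) := by
  induction y using BaseChange.induction with
  | zero => simp only [map_zero]
  | tmul b m => rw [map_tmul, coord_tmul, coord_tmul, map_smul]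
  | add x y hx hy => simp only [map_add, hx, hy]

include F in
theorem map_injective {f : M →ₗ[A] N} (hf : Function.Injective f) :
    Function.Injective (BaseChange.map φ f) := by
  intro x y hxy
  rw [← F.sum_tmul_coord x, ← F.sum_tmul_coord y]
  refine Finset.sum_congr rfl fun i _ => congrArg _ (hf ?_)
  rw [← coord_map, ← coord_map, hxy]

include F in
/-- Base change along a normal Frobenius extension preserves projective covers. -/
theorem isProjectiveCover_map {π : M →ₗ[A] N} (hπ : IsProjectiveCover π) :
    IsProjectiveCover (BaseChange.map φ π) where
  projective := BaseChange.projective hπ.projective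
  surjective := BaseChange.map_surjective hπ.surjective
  essential L hL := by
    -- Superfluity is proved over `A`, where the maps `T i` are semilinear along `σ i`; coordinates
    -- place the kernel inside the sum of the images of `ker π`.
    let _ : Module A (BaseChange φ M) := Module.compHom _ φ
    have smul_def : ∀ (a : A) (y : BaseChange φ M), a • y = φ a • y := fun _ _ => rfl
    let T (i : ι) : M →ₛₗ[(F.σ i : A →+* A)] BaseChange φ M :=
      { toFun := tmul φ (F.t i)
        map_add' := tmul_add _
        map_smul' := fun a m => by
          rw [smul_def, BaseChange.smul_tmul, ← mul_tmul, F.t_mul]; rfl }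
    let L' : Submodule A (BaseChange φ M) :=
      { L.toAddSubmonoid with smul_mem' := fun a _ hy => L.smul_mem (φ a) hy }
    have key : L' = ⊤ := by
      refine Submodule.IsSuperfluous.iSup
        (K := fun i => (LinearMap.ker π).map (T i))
        (fun i => Submodule.IsSuperfluous.map hπ.essential (T i)) L' (eq_top_iff.2 fun y _ => ?_)
      obtain ⟨l, hl, z, hz, rfl⟩ :=
        Submodule.mem_sup.1 (show y ∈ L ⊔ LinearMap.ker (BaseChange.map φ π) by rw [hL]; trivial)
      refine Submodule.add_mem_sup hl ?_
      rw [← F.sum_tmul_coord z]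
      refine Submodule.sum_mem _ fun i _ => Submodule.mem_iSup_of_mem i ⟨F.coord M i z, ?_, rfl⟩
      change π (F.coord M i z) = 0
      rw [← F.coord_map, LinearMap.mem_ker.1 hz, map_zero]
    refine eq_top_iff.2 fun y _ => ?_
    have : y ∈ L' := key ▸ Submodule.mem_top
    exact this

include F in
/-- The kernel of `B ⊗_A f` is `B ⊗_A ker f`. -/
theorem exists_baseChange_ker_equiv (f : M →ₗ[A] N) :
    ∃ e : BaseChange φ (LinearMap.ker f) ≃ₗ[B] LinearMap.ker (BaseChange.map φ f),
      ∀ y, (e y : BaseChange φ M) = BaseChange.map φ (LinearMap.ker f).subtype y := by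
  have hmem : ∀ y, BaseChange.map φ (LinearMap.ker f).subtype y ∈
      LinearMap.ker (BaseChange.map φ f) := by
    intro y
    rw [LinearMap.mem_ker, ← F.sum_tmul_coord (BaseChange.map φ f _)]
    refine Finset.sum_eq_zero fun i _ => ?_
    rw [F.coord_map, F.coord_map]
    rw [show f ((LinearMap.ker f).subtype (F.coord (LinearMap.ker f) i y)) = 0 from
      (F.coord (LinearMap.ker f) i y).2, ← smul_unit, map_zero, smul_zero]
  refine ⟨LinearEquiv.ofBijective ((BaseChange.map φ (LinearMap.ker f).subtype).codRestrict _ hmem)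
    ⟨?_, ?_⟩, fun _ => rfl⟩
  · intro x y hxy
    exact F.map_injective (LinearMap.ker f).injective_subtype (congrArg Subtype.val hxy)
  · rintro ⟨z, hz⟩
    have hz' : ∀ i, f (F.coord M i z) = 0 := fun i => by
      rw [← F.coord_map, LinearMap.mem_ker.1 hz, map_zero]
    refine ⟨∑ i, tmul φ (F.t i) ⟨F.coord M i z, hz' i⟩, Subtype.ext ?_⟩
    change BaseChange.map φ (LinearMap.ker f).subtype _ = z
    rw [map_sum]
    simp_rw [map_tmul]
    exact F.sum_tmul_coord z

end NormalFrobeniusSystem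

end FrobeniusExtension

/-! ### The group algebra over that of a normal subgroup -/

section GroupAlgebra

variable (k : Type u) [Field k] {Gt : Type v} [Group Gt] (G : Subgroup Gt)

namespace MonoidAlgebra

theorem comapDomain_subtype_single_of_mem {g : Gt} (hg : g ∈ G) (c : k) :
    comapDomain G.subtype G.subtype_injective (single g c) = single ⟨g, hg⟩ c :=
  comapDomain_single_map G.subtype G.subtype_injective ⟨g, hg⟩ c

theorem comapDomain_subtype_single_of_notMem {g : Gt} (hg : g ∉ G) (c : k) :
    comapDomain G.subtype G.subtype_injective (single g c) = 0 :=
  comapDomain_single_of_not_mem_range (by rintro ⟨h, rfl⟩; exact hg h.2) _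

end MonoidAlgebra

open MonoidAlgebra in
/-- The group algebra of a finite group is a Frobenius extension of the group algebra of a normal
subgroup. -/
noncomputable def groupAlgebraFrobeniusSystem [G.Normal] [Fintype (Gt ⧸ G)] :
    NormalFrobeniusSystem (mapDomainRingHom k G.subtype) (Gt ⧸ G) where
  E := comapDomainAddMonoidHom G.subtype G.subtype_injective
  E_mul_left a b := by
    induction a using MonoidAlgebra.induction_linear with
    | zero => simp
    | add x y hx hy => rw [map_add, add_mul, map_add, hx, hy, add_mul]
    | single h c =>
    induction b using MonoidAlgebra.induction_linear with
    | zero => simp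
    | add x y hx hy => rw [mul_add, map_add, hx, hy, map_add, mul_add]
    | single g d =>
    rw [mapDomainRingHom_apply, mapDomain_single, Subgroup.subtype_apply, single_mul_single,
      comapDomainAddMonoidHom_apply, comapDomainAddMonoidHom_apply]
    by_cases hg : g ∈ G
    · rw [comapDomain_subtype_single_of_mem k G hg,
        comapDomain_subtype_single_of_mem k G (G.mul_mem h.2 hg), single_mul_single]
      rfl
    · rw [comapDomain_subtype_single_of_notMem k G hg, mul_zero,
        comapDomain_subtype_single_of_notMem k G]
      exact fun h' => hg ((G.mul_mem_cancel_left h.2).1 h')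
  E_mul_right b a := by
    induction a using MonoidAlgebra.induction_linear with
    | zero => simp
    | add x y hx hy => rw [map_add, mul_add, map_add, hx, hy, mul_add]
    | single h c =>
    induction b using MonoidAlgebra.induction_linear with
    | zero => simp
    | add x y hx hy => rw [add_mul, map_add, hx, hy, map_add, add_mul]
    | single g d =>
    rw [mapDomainRingHom_apply, mapDomain_single, Subgroup.subtype_apply, single_mul_single,
      comapDomainAddMonoidHom_apply, comapDomainAddMonoidHom_apply]
    by_cases hg : g ∈ G
    · rw [comapDomain_subtype_single_of_mem k G hg,
        comapDomain_subtype_single_of_mem k G (G.mul_mem hg h.2), single_mul_single]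
      rfl
    · rw [comapDomain_subtype_single_of_notMem k G hg, zero_mul,
        comapDomain_subtype_single_of_notMem k G]
      exact fun h' => hg ((G.mul_mem_cancel_right h.2).1 h')
  t q := single q.out 1
  s q := single q.out⁻¹ 1
  sum_mul_s b := by
    induction b using MonoidAlgebra.induction_linear with
    | zero => simp
    | add x y hx hy => simp_rw [add_mul, map_add, add_mul, Finset.sum_add_distrib, hx, hy]
    | single g c =>
    -- Only the coset of `g⁻¹` contributes, and its term is `(g * q.out) * q.out⁻¹ = g`.
    have hmem : ∀ q : Gt ⧸ G, g * q.out ∈ G ↔ q = (g⁻¹ : Gt) := fun q => by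
      rw [eq_comm, ← QuotientGroup.out_eq' q, QuotientGroup.eq, QuotientGroup.out_eq', inv_inv]
    rw [Finset.sum_eq_single ((g⁻¹ : Gt) : Gt ⧸ G)]
    · rw [single_mul_single, comapDomainAddMonoidHom_apply,
        comapDomain_subtype_single_of_mem k G ((hmem _).2 rfl), mapDomainRingHom_apply,
        mapDomain_single, single_mul_single]
      simp
    · intro q _ hq
      rw [single_mul_single, comapDomainAddMonoidHom_apply,
        comapDomain_subtype_single_of_notMem k G (mt (hmem q).1 hq), map_zero, zero_mul]
    · simp
  sum_t_mul b := by
    induction b using MonoidAlgebra.induction_linear with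
    | zero => simp
    | add x y hx hy => simp_rw [mul_add, map_add, mul_add, Finset.sum_add_distrib, hx, hy]
    | single g c =>
    have hmem : ∀ q : Gt ⧸ G, q.out⁻¹ * g ∈ G ↔ q = (g : Gt) := fun q => by
      rw [← QuotientGroup.eq, QuotientGroup.out_eq']
    rw [Finset.sum_eq_single (g : Gt ⧸ G)]
    · rw [single_mul_single, comapDomainAddMonoidHom_apply,
        comapDomain_subtype_single_of_mem k G ((hmem _).2 rfl), mapDomainRingHom_apply,
        mapDomain_single, single_mul_single]
      simp
    · intro q _ hq
      rw [single_mul_single, comapDomainAddMonoidHom_apply,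
        comapDomain_subtype_single_of_notMem k G (mt (hmem q).1 hq), map_zero, mul_zero]
    · simp
  -- Normality of `G` enters here: `q.out * h = (q.out * h * q.out⁻¹) * q.out`.
  σ q := mapDomainRingEquiv k (MulAut.conjNormal q.out)
  t_mul q a := by
    induction a using MonoidAlgebra.induction_linear with
    | zero => simp
    | add x y hx hy => simp only [map_add, mul_add, add_mul, hx, hy]
    | single h c =>
    rw [mapDomainRingEquiv_single, mapDomainRingHom_apply, mapDomainRingHom_apply,
      mapDomain_single, mapDomain_single, single_mul_single, single_mul_single]
    simp

end GroupAlgebra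

/-! ### Duals of transposes under base change -/

section DualTranspose

open MulOpposite BaseChange

variable {A B : Type*} [Ring A] [Ring B] {φ : A →+* B} {ι : Type*} [Fintype ι]

namespace NormalFrobeniusSystem

variable (F : NormalFrobeniusSystem φ ι)

/-- The model is `X' = X ⊗_A B` with `i x = x ⊗ 1` and `r (x ⊗ b) = x · E b`. The isomorphism sends
`b ⊗ ξ` to `b • (ξ ∘ r)`. By `hri`, the functionals `(s j • ψ) ∘ i` recover the coordinates, whence
injectivity; by `hir`, they rebuild `ψ`, whence surjectivity. -/
theorem nonempty_baseChange_kDual_equiv {k : Type u} [Field k] [Algebra k A] [Algebra k B]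
    (hφ : ∀ c, φ (algebraMap k A c) = algebraMap k B c)
    {X X' : Type*} [AddCommGroup X] [Module k X] [Module Aᵐᵒᵖ X] [IsScalarTower k Aᵐᵒᵖ X]
    [AddCommGroup X'] [Module k X'] [Module Bᵐᵒᵖ X'] [IsScalarTower k Bᵐᵒᵖ X']
    (i : X →+ X') (r : X' →+ X) (hi : ∀ a x, i (op a • x) = op (φ a) • i x)
    (hr : ∀ a x, r (op (φ a) • x) = op a • r x)
    (hir : ∀ x, ∑ j, op (F.s j) • i (r (op (F.t j) • x)) = x)
    (hri : ∀ b x, r (op b • i x) = op (F.E b) • x) :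
    Nonempty (BaseChange φ (KDual k X) ≃ₗ[B] KDual k X') := by
  let iL : X →ₗ[k] X' :=
    { i with
      map_smul' := fun c x => by
        change i (c • x) = c • i x
        rw [← algebraMap_smul Aᵐᵒᵖ c x, ← algebraMap_smul Bᵐᵒᵖ c (i x), MulOpposite.algebraMap_apply,
          MulOpposite.algebraMap_apply, hi, hφ] }
  let rL : X' →ₗ[k] X :=
    { r with
      map_smul' := fun c x => by
        change r (c • x) = c • r x
        rw [← algebraMap_smul Aᵐᵒᵖ c (r x), ← algebraMap_smul Bᵐᵒᵖ c x, MulOpposite.algebraMap_apply,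
          MulOpposite.algebraMap_apply, ← hφ, hr] }
  let f : KDual k X →ₛₗ[φ] KDual k X' :=
    { toFun := fun ξ => (show X →ₗ[k] k from ξ).comp rL
      map_add' := fun _ _ => rfl
      map_smul' := fun a ξ => LinearMap.ext fun x =>
        congrArg (show X →ₗ[k] k from ξ) (hr a x).symm }
  let c (j : ι) : KDual k X' →+ KDual k X :=
    AddMonoidHom.mk' (fun ψ => (show X' →ₗ[k] k from F.s j • ψ).comp iL)
      fun ψ ψ' => by rw [smul_add]; rfl
  have hc : ∀ j y, c j (lift f y) = F.coord (KDual k X) j y := fun j y => by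
    induction y using BaseChange.induction with
    | zero => simp only [map_zero]
    | add x y hx hy => simp only [map_add, hx, hy]
    | tmul b ξ =>
      refine LinearMap.ext fun x => congrArg (show X →ₗ[k] k from ξ) ?_
      change r (op b • op (F.s j) • i x) = op (F.E (F.s j * b)) • x
      rw [← mul_smul, ← op_mul, hri]
  refine ⟨LinearEquiv.ofBijective (lift f) ⟨?_, fun ψ => ?_⟩⟩
  · intro y z hyz
    rw [← F.sum_tmul_coord y, ← F.sum_tmul_coord z]
    simp_rw [← hc, hyz]
  · refine ⟨∑ j, tmul φ (F.t j) (c j ψ), ?_⟩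
    rw [map_sum]
    refine LinearMap.ext fun x => ?_
    refine (LinearMap.sum_apply (M := X') (M₂ := k) Finset.univ _ x).trans ?_
    conv_rhs => rw [← hir x]
    exact (map_sum (show X' →ₗ[k] k from ψ) _ _).symm

section HomRegular

variable {P P' Q Q' : Type*} [AddCommGroup P] [Module A P] [AddCommGroup P'] [Module B P']
  [AddCommGroup Q] [Module A Q] [AddCommGroup Q'] [Module B Q']

/-- Base change of linear forms. -/
def baseChangeForm (e : BaseChange φ P ≃ₗ[B] P') : (P →ₗ[A] A) →+ (P' →ₗ[B] B) :=
  AddMonoidHom.mk' (fun f => (lift (X := B)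
      { toFun := fun p => φ (f p)
        map_add' := fun p q => by rw [map_add, map_add]
        map_smul' := fun a p => by rw [map_smul, smul_eq_mul, map_mul, smul_eq_mul] }).comp
      e.symm.toLinearMap) fun f g => by
    rw [← LinearMap.add_comp]
    refine congrArg (LinearMap.comp · e.symm.toLinearMap) (hom_ext fun p => ?_)
    rw [LinearMap.add_apply, lift_tmul, lift_tmul, lift_tmul, ← smul_add]
    exact congrArg ((1 : B) • ·) (map_add φ (f p) (g p))

theorem baseChangeForm_apply (e : BaseChange φ P ≃ₗ[B] P') (f : P →ₗ[A] A) (p : P) :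
    baseChangeForm e f (e (tmul φ 1 p)) = φ (f p) := by
  change lift (X := B) _ (e.symm (e _)) = _
  rw [e.symm_apply_apply, lift_tmul, one_smul]
  rfl

theorem form_ext (e : BaseChange φ P ≃ₗ[B] P') {f g : P' →ₗ[B] B}
    (h : ∀ p, f (e (tmul φ 1 p)) = g (e (tmul φ 1 p))) : f = g := by
  have : f.comp e.toLinearMap = g.comp e.toLinearMap := hom_ext h
  ext y
  obtain ⟨y, rfl⟩ := e.surjective y
  exact LinearMap.congr_fun this y

/-- Restriction of linear forms followed by the Frobenius homomorphism. -/
def restrictForm (e : BaseChange φ P ≃ₗ[B] P') : (P' →ₗ[B] B) →+ (P →ₗ[A] A) :=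
  AddMonoidHom.mk' (fun f =>
      { toFun := fun p => F.E (f (e (unit φ P p)))
        map_add' := fun p q => by simp only [map_add]
        map_smul' := fun a p => by
          rw [map_smulₛₗ, map_smul, map_smul, smul_eq_mul, F.E_mul_left]; rfl }) fun f g =>
    LinearMap.ext fun p => map_add F.E (f (e (unit φ P p))) (g (e (unit φ P p)))

theorem restrictForm_apply (e : BaseChange φ P ≃ₗ[B] P') (f : P' →ₗ[B] B) (p : P) :
    F.restrictForm e f p = F.E (f (e (tmul φ 1 p))) := rfl

include F in
/-- The `k`-dual of the cokernel of `Hom(d, A)` base changes to the `k`-dual of the cokernel of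
`Hom(d', B)`, for `d'` isomorphic to the base change of `d`. -/
theorem nonempty_baseChange_kDual_coker_equiv {k : Type u} [Field k] [Algebra k A] [Algebra k B]
    (hφ : ∀ c, φ (algebraMap k A c) = algebraMap k B c) (d : P →ₗ[A] Q) (d' : P' →ₗ[B] Q')
    (e : BaseChange φ P ≃ₗ[B] P') (e' : BaseChange φ Q ≃ₗ[B] Q')
    (he : ∀ y, d' (e y) = e' (BaseChange.map φ d y)) :
    Nonempty (BaseChange φ (KDual k ((P →ₗ[A] A) ⧸ LinearMap.range (homRegularMap A d))) ≃ₗ[B]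
      KDual k ((P' →ₗ[B] B) ⧸ LinearMap.range (homRegularMap B d'))) := by
  have he1 : ∀ p, d' (e (tmul φ 1 p)) = e' (tmul φ 1 (d p)) := fun p => by rw [he, map_tmul]
  let i : ((P →ₗ[A] A) ⧸ LinearMap.range (homRegularMap A d)) →+
      ((P' →ₗ[B] B) ⧸ LinearMap.range (homRegularMap B d')) :=
    QuotientAddGroup.map (LinearMap.range (homRegularMap A d)).toAddSubgroup
      (LinearMap.range (homRegularMap B d')).toAddSubgroup (baseChangeForm e) (by
        rintro _ ⟨f, rfl⟩
        refine ⟨baseChangeForm e' f, form_ext e fun p => ?_⟩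
        rw [baseChangeForm_apply]
        change baseChangeForm e' f (d' (e (tmul φ 1 p))) = φ (f (d p))
        rw [he1, baseChangeForm_apply])
  let r : ((P' →ₗ[B] B) ⧸ LinearMap.range (homRegularMap B d')) →+
      ((P →ₗ[A] A) ⧸ LinearMap.range (homRegularMap A d)) :=
    QuotientAddGroup.map (LinearMap.range (homRegularMap B d')).toAddSubgroup
      (LinearMap.range (homRegularMap A d)).toAddSubgroup (F.restrictForm e) (by
        rintro _ ⟨f, rfl⟩
        refine ⟨F.restrictForm e' f, LinearMap.ext fun p => ?_⟩
        rw [restrictForm_apply]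
        change F.E (f (e' (tmul φ 1 (d p)))) = F.E (f (d' (e (tmul φ 1 p))))
        rw [he1])
  have hi : ∀ f, i (Submodule.Quotient.mk f) = Submodule.Quotient.mk (baseChangeForm e f) :=
    fun _ => rfl
  have hr : ∀ f, r (Submodule.Quotient.mk f) = Submodule.Quotient.mk (F.restrictForm e f) :=
    fun _ => rfl
  -- All four identities hold already for linear forms; the last two reduce to `sum_mul_s` and
  -- `E_mul_left`.
  refine F.nonempty_baseChange_kDual_equiv hφ i r (fun a x => ?_) (fun a x => ?_) (fun x => ?_)
    (fun b x => ?_)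
  · obtain ⟨f, rfl⟩ := Submodule.Quotient.mk_surjective _ x
    rw [← Submodule.Quotient.mk_smul, hi, hi, ← Submodule.Quotient.mk_smul]
    refine congrArg _ (form_ext e fun p => ?_)
    rw [baseChangeForm_apply, LinearMap.smul_apply, LinearMap.smul_apply, baseChangeForm_apply,
      op_smul_eq_mul, op_smul_eq_mul, map_mul]
  · obtain ⟨f, rfl⟩ := Submodule.Quotient.mk_surjective _ x
    rw [← Submodule.Quotient.mk_smul, hr, hr, ← Submodule.Quotient.mk_smul]
    refine congrArg _ (LinearMap.ext fun p => ?_)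
    rw [restrictForm_apply, LinearMap.smul_apply, LinearMap.smul_apply, restrictForm_apply,
      op_smul_eq_mul, op_smul_eq_mul, F.E_mul_right]
  · obtain ⟨f, rfl⟩ := Submodule.Quotient.mk_surjective _ x
    simp_rw [← Submodule.Quotient.mk_smul, hr, hi, ← Submodule.Quotient.mk_smul]
    rw [← Submodule.mkQ_apply]
    simp_rw [← Submodule.mkQ_apply]
    rw [← map_sum]
    refine congrArg _ (form_ext e fun p => ?_)
    rw [LinearMap.sum_apply]
    simp_rw [LinearMap.smul_apply, baseChangeForm_apply, restrictForm_apply, LinearMap.smul_apply,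
      op_smul_eq_mul]
    exact F.sum_mul_s _
  · obtain ⟨f, rfl⟩ := Submodule.Quotient.mk_surjective _ x
    rw [hi, ← Submodule.Quotient.mk_smul, hr, ← Submodule.Quotient.mk_smul]
    refine congrArg _ (LinearMap.ext fun p => ?_)
    rw [restrictForm_apply, LinearMap.smul_apply, baseChangeForm_apply, LinearMap.smul_apply,
      op_smul_eq_mul, op_smul_eq_mul, F.E_mul_left]

end HomRegular

end NormalFrobeniusSystem

end DualTranspose

/-! ### Syzygies and Auslander–Reiten translates under base change -/

section Syzygy

variable {A : Type u} {B : Type v} [Ring A] [Ring B] [IsArtinianRing A] [IsArtinianRing B]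
  {φ : A →+* B} {ι : Type*} [Fintype ι] (F : NormalFrobeniusSystem φ ι)
  (M : Type w) [AddCommGroup M] [Module A M] [Module.Finite A M]

namespace NormalFrobeniusSystem

include F

theorem exists_baseChange_projCover_equiv :
    ∃ e : BaseChange φ (ProjCover A M) ≃ₗ[B] ProjCover B (BaseChange φ M),
      ∀ y, projCoverMap B (BaseChange φ M) (e y) = BaseChange.map φ (projCoverMap A M) y :=
  (F.isProjectiveCover_map (isProjectiveCover_projCoverMap A M)).exists_equiv
    (isProjectiveCover_projCoverMap B _) (LinearEquiv.refl B _)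

/-- The equivalence `e` is an argument so that the same one serves as the right-hand column of the
presentation square for `τ`. -/
theorem exists_baseChange_syzygy_equiv
    (e : BaseChange φ (ProjCover A M) ≃ₗ[B] ProjCover B (BaseChange φ M))
    (he : ∀ y, projCoverMap B (BaseChange φ M) (e y) = BaseChange.map φ (projCoverMap A M) y) :
    ∃ f : BaseChange φ (Syzygy A M) ≃ₗ[B] Syzygy B (BaseChange φ M),
      ∀ y, (f y : ProjCover B (BaseChange φ M)) =
        e (BaseChange.map φ (LinearMap.ker (projCoverMap A M)).subtype y) := by
  obtain ⟨g, hg⟩ := F.exists_baseChange_ker_equiv (projCoverMap A M)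
  obtain ⟨f, hf⟩ := LinearMap.exists_ker_equiv (π := BaseChange.map φ (projCoverMap A M))
    (π' := projCoverMap B (BaseChange φ M)) e (LinearEquiv.refl B _) he
  exact ⟨g ≪≫ₗ f, fun y => by rw [← hg]; exact hf _⟩

theorem nonempty_baseChange_arTranslate_equiv (k : Type*) [Field k] [Algebra k A] [Algebra k B]
    (hφ : ∀ c, φ (algebraMap k A c) = algebraMap k B c) :
    Nonempty (BaseChange φ (ARTranslate A M k) ≃ₗ[B] ARTranslate B (BaseChange φ M) k) := by
  obtain ⟨e, he⟩ := F.exists_baseChange_projCover_equiv M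
  obtain ⟨f, hf⟩ := F.exists_baseChange_syzygy_equiv M e he
  obtain ⟨g, hg⟩ := (F.isProjectiveCover_map
    (isProjectiveCover_projCoverMap A (Syzygy A M))).exists_equiv
    (isProjectiveCover_projCoverMap B (Syzygy B (BaseChange φ M))) f
  refine F.nonempty_baseChange_kDual_coker_equiv hφ _ _ g e fun y => ?_
  -- The presentation map factors through the syzygy, so the square splits into the two squares
  -- given by `hg` and `hf`.
  have h : BaseChange.map φ (minPresMap A M) = (BaseChange.map φ
      (LinearMap.ker (projCoverMap A M)).subtype).comp
      (BaseChange.map φ (projCoverMap A (Syzygy A M))) :=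
    BaseChange.hom_ext fun p => by
      rw [LinearMap.comp_apply, BaseChange.map_tmul, BaseChange.map_tmul, BaseChange.map_tmul]; rfl
  change ((projCoverMap B (Syzygy B (BaseChange φ M)) (g y) : Syzygy B (BaseChange φ M)) :
    ProjCover B (BaseChange φ M)) = _
  rw [hg, hf, h]
  rfl

end NormalFrobeniusSystem

end Syzygy

/-! ### Conjugate modules -/

section Conjugate

variable {k : Type u} [Field k] {Gt : Type v} [Group Gt] {G : Subgroup Gt} [G.Normal]

open MonoidAlgebra

variable (k G) in
/-- The automorphism of the group algebra of `G` induced by conjugation with `x⁻¹`. -/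
noncomputable def conjRingEquiv (x : Gt) : MonoidAlgebra k G ≃+* MonoidAlgebra k G :=
  mapDomainRingEquiv k (MulAut.conjNormal x⁻¹ : MulAut G)

instance (x : Gt) : RingHomInvPair (conjRingEquiv k G x : MonoidAlgebra k G →+* MonoidAlgebra k G)
    (conjRingEquiv k G x).symm := RingHomInvPair.of_ringEquiv _

instance (x : Gt) : RingHomInvPair
    ((conjRingEquiv k G x).symm : MonoidAlgebra k G →+* MonoidAlgebra k G)
    (conjRingEquiv k G x) := RingHomInvPair.of_ringEquiv (conjRingEquiv k G x).symm

/-- The identity, as a semilinear equivalence from a module to its conjugate. -/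
def conjModEquiv (x : Gt) (N : Type*) [AddCommGroup N] [Module (MonoidAlgebra k G) N] :
    N ≃ₛₗ[((conjRingEquiv k G x).symm : MonoidAlgebra k G →+* MonoidAlgebra k G)] ConjMod x N :=
  { AddEquiv.refl N with
    -- On the conjugate, `a` acts as `conjRingEquiv k G x a` does on `N`, so the identity is
    -- semilinear along the inverse.
    map_smul' := fun a y => by
      change a • y = conjRingEquiv k G x ((conjRingEquiv k G x).symm a) • y
      rw [RingEquiv.apply_symm_apply] }

/-- A projective cover of an invariant module is invariant, compatibly with the covering map. -/
theorem IsProjectiveCover.exists_conjMod_equiv (x : Gt) {P M : Type*} [AddCommGroup P]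
    [Module (MonoidAlgebra k G) P] [AddCommGroup M] [Module (MonoidAlgebra k G) M]
    {π : P →ₗ[MonoidAlgebra k G] M} (hπ : IsProjectiveCover π)
    (h : ConjMod x M ≃ₗ[MonoidAlgebra k G] M) :
    ∃ e : ConjMod x P ≃ₗ[MonoidAlgebra k G] P,
      ∀ y : P, π (e (show ConjMod x P from y)) = h (show ConjMod x M from π y) := by
  let πx : ConjMod x P →ₗ[MonoidAlgebra k G] ConjMod x M :=
    { toFun := fun y => π (show P from y)
      map_add' := fun y z => π.map_add y z
      map_smul' := fun a y => π.map_smul _ _ }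
  have hπx : IsProjectiveCover πx :=
    hπ.of_semilinearEquiv (conjModEquiv x P) (conjModEquiv x M) fun _ => rfl
  exact hπx.exists_equiv hπ h

/-- Conjugation leaves the underlying group unchanged, and `he` with `h` injective makes `e`
preserve and reflect membership in `ker π`. -/
theorem LinearMap.nonempty_conjMod_ker_equiv (x : Gt) {P M : Type*} [AddCommGroup P]
    [Module (MonoidAlgebra k G) P] [AddCommGroup M] [Module (MonoidAlgebra k G) M]
    (π : P →ₗ[MonoidAlgebra k G] M) (e : ConjMod x P ≃ₗ[MonoidAlgebra k G] P)
    (h : ConjMod x M ≃ₗ[MonoidAlgebra k G] M)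
    (he : ∀ y : P, π (e (show ConjMod x P from y)) = h (show ConjMod x M from π y)) :
    Nonempty (ConjMod x (LinearMap.ker π) ≃ₗ[MonoidAlgebra k G] LinearMap.ker π) := by
  have hmem : ∀ y : P, π (e (show ConjMod x P from y)) = 0 ↔ π y = 0 := fun y => by
    rw [he]
    exact h.map_eq_zero_iff
  let f : ConjMod x (LinearMap.ker π) →ₗ[MonoidAlgebra k G] LinearMap.ker π :=
    { toFun := fun y => ⟨e (show LinearMap.ker π from y).1,
        (hmem _).2 (show LinearMap.ker π from y).2⟩
      map_add' := fun y z => Subtype.ext (e.map_add _ _)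
      map_smul' := fun a y => Subtype.ext
        (e.map_smul a (show ConjMod x P from (show LinearMap.ker π from y).1)) }
  refine ⟨LinearEquiv.ofBijective f ⟨fun y z hyz => ?_, ?_⟩⟩
  · exact Subtype.ext (e.injective (congrArg Subtype.val hyz))
  · rintro ⟨z, hz⟩
    obtain ⟨y, rfl⟩ := e.surjective z
    exact ⟨⟨y, (hmem y).1 hz⟩, rfl⟩

end Conjugate

theorem mainTheorem5 {k : Type u} [Field k] [IsAlgClosed k] (p : ℕ) (hp : 0 < p) [CharP k p]
    {Gt : Type v} [Group Gt] [Finite Gt] (G : Subgroup Gt) [G.Normal]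
    (M : Type w) [AddCommGroup M] [Module (MonoidAlgebra k G) M]
    [Module.Finite (MonoidAlgebra k G) M]
    (hM : ∀ x : Gt, Nonempty (ConjMod x M ≃ₗ[MonoidAlgebra k G] M)) :
    (∀ x : Gt, Nonempty (ConjMod x (ProjCover (MonoidAlgebra k G) M) ≃ₗ[MonoidAlgebra k G]
      ProjCover (MonoidAlgebra k G) M)) ∧
    (∀ x : Gt, Nonempty (ConjMod x (Syzygy (MonoidAlgebra k G) M) ≃ₗ[MonoidAlgebra k G]
      Syzygy (MonoidAlgebra k G) M)) ∧
    Nonempty (Ind k G (Syzygy (MonoidAlgebra k G) M) ≃ₗ[MonoidAlgebra k Gt]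
      Syzygy (MonoidAlgebra k Gt) (Ind k G M)) ∧
    Nonempty (ARTranslate (MonoidAlgebra k Gt) (Ind k G M) k ≃ₗ[MonoidAlgebra k Gt]
      Ind k G (ARTranslate (MonoidAlgebra k G) M k)) := by
  have := Fintype.ofFinite (Gt ⧸ G)
  have hπ := isProjectiveCover_projCoverMap (MonoidAlgebra k G) M
  let F := groupAlgebraFrobeniusSystem k G
  refine ⟨fun x => ?_, fun x => ?_, ?_, ?_⟩
  · obtain ⟨h⟩ := hM x
    obtain ⟨e, -⟩ := hπ.exists_conjMod_equiv x h
    exact ⟨e⟩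
  · obtain ⟨h⟩ := hM x
    obtain ⟨e, he⟩ := hπ.exists_conjMod_equiv x h
    exact LinearMap.nonempty_conjMod_ker_equiv x (projCoverMap (MonoidAlgebra k G) M) e h he
  · obtain ⟨e, he⟩ := F.exists_baseChange_projCover_equiv M
    obtain ⟨f, -⟩ := F.exists_baseChange_syzygy_equiv M e he
    exact ⟨f⟩
  -- The side condition is that the inclusion of group algebras fixes the scalars from `k`.
  · obtain ⟨f⟩ := F.nonempty_baseChange_arTranslate_equiv M k fun c => by
      simp [MonoidAlgebra.coe_algebraMap]
    exact ⟨f.symm⟩
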